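/- Let $d\ge 0$ be an integer and let $P\subset\mathbb{R}^d$ be a closed convex cone (containing $0$) which is spanning, $P-P=\mathbb{R}^d$, and pointed, $P\cap(-P)=\{0\}$. Let $\mathbb{T}=\{z\in\mathbb{C}:|z|=1\}$. A multiplier on $P$ is a continuous function $\omega:P\times P\to\mathbb{T}$ with $$\omega(x,y)\,\omega(x+y,z)=\omega(x,y+z)\,\omega(y,z)\qquad\text{for all }x,y,z\in P.$$ The multipliers form an abelian group $Z^2(P,\mathbb{T})$ under pointwise multiplication. Let $B^2(P,\mathbb{T})$ be its subgroup of coboundaries $\omega_\psi(x,y)=\psi(x)\psi(y)\psi(x+y)^{-1}$, where $\psi:P\to\mathbb{T}$ is continuous, and let $H^2(P,\mathbb{T})=Z^2(P,\mathbb{T})/B^2(P,\mathbb{T})$; write $[\omega]$ for the class of $\omega\in Z^2(P,\mathbb{T})$. Let $B_0(d)$ be the additive group of strictly upper triangular real $d\times d$ matrices, and for $A\in B_0(d)$ let $\omega_A(x,y)=e^{i\langle Ax|y\rangle}$ for $x,y\in P$, where $\langle\cdot|\cdot\rangle$ is the standard inner product of $\mathbb{R}^d$; this is a multiplier on $P$.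 Then the map $$B_0(d)\to H^2(P,\mathbb{T}),\qquad A\mapsto[\omega_A],$$ is an isomorphism of groups. -/

import Mathlib

open scoped Matrix Pointwise

namespace ConeCohomology

section Cohomology

variable (S : Type*) [AddCommMonoid S] [TopologicalSpace S]

/-- The group `Z²(S, 𝕋)` of multipliers on `S`: continuous functions `ω : S × S → 𝕋` with
`ω(x, y) ω(x + y, z) = ω(x, y + z) ω(y, z)`, under pointwise multiplication. -/
noncomputable def Z2 : Subgroup C(S × S, Circle) where
  carrier := {ω | ∀ x y z : S, ω (x, y) * ω (x + y, z) = ω (x, y + z) * ω (y, z)}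
  one_mem' := by intro x y z; simp
  mul_mem' := by
    intro a b ha hb x y z
    simp only [ContinuousMap.mul_apply]
    rw [mul_mul_mul_comm, ha x y z, hb x y z, mul_mul_mul_comm]
  inv_mem' := by
    intro a ha x y z
    have h := congrArg (fun t : Circle => t⁻¹) (ha x y z)
    simp only [mul_inv] at h
    exact h

variable [ContinuousAdd S]

/-- The coboundary map `ψ ↦ ω_ψ`, `ω_ψ(x, y) = ψ(x) ψ(y) ψ(x + y)⁻¹`, defined on continuous
functions `ψ : S → 𝕋`. -/
noncomputable def coboundary : C(S, Circle) →* Z2 S where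
  toFun ψ :=
    ⟨⟨fun p => ψ p.1 * ψ p.2 * (ψ (p.1 + p.2))⁻¹, by fun_prop⟩, by
      intro x y z
      simp only [ContinuousMap.coe_mk, add_assoc]
      have h : ∀ a b c d e f : Circle,
          a * b * d⁻¹ * (d * c * f⁻¹) = a * e * f⁻¹ * (b * c * e⁻¹) := by
        intro a b c d e f
        calc a * b * d⁻¹ * (d * c * f⁻¹) = a * b * c * f⁻¹ * (d⁻¹ * d) := by
              simp only [mul_comm, mul_left_comm, mul_assoc]
          _ = a * b * c * f⁻¹ * (e⁻¹ * e) := by rw [inv_mul_cancel, inv_mul_cancel]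
          _ = a * e * f⁻¹ * (b * c * e⁻¹) := by
              simp only [mul_comm, mul_left_comm, mul_assoc]
      exact h _ _ _ _ _ _⟩
  map_one' := by
    ext p; simp
  map_mul' ψ φ := by
    ext p
    simp
    ring

/-- The subgroup `B²(S, 𝕋)` of coboundaries. -/
noncomputable def B2 : Subgroup (Z2 S) := (coboundary S).range

/-- The continuous second cohomology group `H²(S, 𝕋) = Z²(S, 𝕋) / B²(S, 𝕋)`. -/
abbrev H2 : Type _ := Z2 S ⧸ B2 S

end Cohomology

/-- The additive group `B₀(d)` of strictly upper triangular real `d × d` matrices. -/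
def strictUpper (d : ℕ) : AddSubgroup (Matrix (Fin d) (Fin d) ℝ) where
  carrier := {A | ∀ i j, j ≤ i → A i j = 0}
  zero_mem' := by intro i j _; rfl
  add_mem' := by
    intro A B hA hB i j hij
    simp [hA i j hij, hB i j hij]
  neg_mem' := by
    intro A hA i j hij
    simp [hA i j hij]

instance {d : ℕ} (P : PointedCone ℝ (EuclideanSpace ℝ (Fin d))) : ContinuousAdd P :=
  inferInstanceAs (ContinuousAdd P.toAddSubmonoid)

/-- The multiplier `ω_A(x, y) = exp(i ⟨A x | y⟩)` on the cone `P`. -/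
noncomputable def omega {d : ℕ} (P : PointedCone ℝ (EuclideanSpace ℝ (Fin d)))
    (A : Matrix (Fin d) (Fin d) ℝ) : Z2 P :=
  ⟨⟨fun p => Circle.exp (inner ℝ (Matrix.toEuclideanLin A (p.1 : EuclideanSpace ℝ (Fin d)))
      (p.2 : EuclideanSpace ℝ (Fin d))), by
      have h : Continuous (Matrix.toEuclideanLin A) := LinearMap.continuous_of_finiteDimensional _
      fun_prop⟩, by
    intro x y z
    simp only [ContinuousMap.coe_mk, ← Circle.exp_add]
    congr 1
    simp only [Submodule.coe_add, map_add, inner_add_left, inner_add_right]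
    ring⟩

end ConeCohomology

/-!
A cone `P` is contractible, so a multiplier lifts through `exp : ℝ → 𝕋` to a continuous real
cocycle `c`. The antisymmetrisation `c(x, y) - c(y, x)` is biadditive, hence the restriction of a
skew bilinear form on `ℝᵈ`, and every such form is `⟨A x | y⟩ - ⟨A y | x⟩` for a unique strictly
upper triangular `A`. Subtracting `⟨A x | y⟩` leaves a symmetric cocycle, and this is a coboundary:
averaging it twice against a Lipschitz weight supported in the interior of `P` changes it by
coboundaries into one which is `O(‖x‖ ‖y‖)`, for which the primitive obtained by dyadic subdivision
converges. Conversely, if `ω_A` is a coboundary, then `⟨A x | y⟩ - ⟨A y | x⟩` takes values in `2πℤ`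
on the connected set `P × P`, so it vanishes and `A = 0`.
-/

namespace ConeCohomology

open Filter MeasureTheory Topology
open scoped NNReal

section Cocycle

variable {S A : Type*} [AddCommGroup A]

/-- The coboundary `δf` of a `1`-cochain `f`, written additively. -/
def addCoboundary [Add S] (f : S → A) (x y : S) : A := f x + f y - f (x + y)

theorem addCoboundary_add [Add S] (f g : S → A) :
    addCoboundary (f + g) = addCoboundary f + addCoboundary g := by
  ext x y
  simp only [addCoboundary, Pi.add_apply]
  abel

variable [TopologicalSpace S] [TopologicalSpace A]

/-- A continuous `2`-cocycle on `S` with values in `A` (with trivial action), written additively. -/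
structure IsCocycle [Add S] (c : S → S → A) : Prop where
  continuous : Continuous fun p : S × S ↦ c p.1 p.2
  cocycle : ∀ x y z, c x y + c (x + y) z = c x (y + z) + c y z

/-- A symmetric continuous `2`-cocycle: the additive form of an abelian extension of `S` by `A`. -/
structure IsSymmCocycle [Add S] (c : S → S → A) : Prop extends IsCocycle c where
  symm : ∀ x y, c x y = c y x

theorem isCocycle_of_biadditive [Add S] {b : S → S → A}
    (hb : Continuous fun p : S × S ↦ b p.1 p.2)
    (hleft : ∀ x y z, b (x + y) z = b x z + b y z)
    (hright : ∀ x y z, b x (y + z) = b x y + b x z) : IsCocycle b where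
  continuous := hb
  cocycle x y z := by
    rw [hleft, hright]
    abel

theorem IsCocycle.sub [Add S] [IsTopologicalAddGroup A] {c c' : S → S → A} (hc : IsCocycle c)
    (hc' : IsCocycle c') : IsCocycle (c - c') where
  continuous := hc.continuous.sub hc'.continuous
  cocycle x y z := by
    simp only [Pi.sub_apply]
    linear_combination (norm := abel) hc.cocycle x y z - hc'.cocycle x y z

theorem isSymmCocycle_addCoboundary [AddCommSemigroup S] [ContinuousAdd S]
    [IsTopologicalAddGroup A] {f : S → A} (hf : Continuous f) :
    IsSymmCocycle (addCoboundary f) where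
  continuous := by
    unfold addCoboundary
    fun_prop
  cocycle x y z := by
    simp only [addCoboundary, add_assoc x y z]
    abel
  symm x y := by simp only [addCoboundary, add_comm]

theorem IsSymmCocycle.sub [Add S] [IsTopologicalAddGroup A] {c c' : S → S → A}
    (hc : IsSymmCocycle c) (hc' : IsSymmCocycle c') : IsSymmCocycle (c - c') where
  toIsCocycle := hc.toIsCocycle.sub hc'.toIsCocycle
  symm x y := by simp only [Pi.sub_apply, hc.symm x y, hc'.symm x y]

theorem IsCocycle.swap_sub_add_left [AddCommSemigroup S] {c : S → S → A} (hc : IsCocycle c)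
    (x y z : S) : c (x + y) z - c z (x + y) = c x z - c z x + (c y z - c z y) := by
  have hxyz := hc.cocycle x y z
  have hzxy := hc.cocycle z x y
  have hxzy := hc.cocycle x z y
  rw [add_comm z x] at hzxy
  rw [add_comm z y] at hxzy
  linear_combination (norm := abel) hxyz + hzxy - hxzy

theorem IsSymmCocycle.add_add_self [AddCommSemigroup S] {c : S → S → A} (hc : IsSymmCocycle c)
    (u v : S) :
    c (u + v) (u + v) - c u u - c v v = c (u + u) (v + v) - (c u v + c u v) := by
  have huv := hc.cocycle u v (u + v)
  have huu := hc.cocycle u u (v + v)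
  have hvv := hc.cocycle u v v
  have hsymm := hc.symm (u + v) v
  rw [add_left_comm v u v] at huv
  linear_combination (norm := abel) huv - huu + hvv - hsymm

end Cocycle

section Dyadic

variable {E : Type*} [NormedAddCommGroup E] [NormedSpace ℝ E] {P : PointedCone ℝ E}

instance (P : PointedCone ℝ E) : ContinuousAdd P :=
  inferInstanceAs (ContinuousAdd P.toAddSubmonoid)

/-- The contraction `x ↦ 2⁻ⁿ x` of a cone. -/
noncomputable def dyadicScale (n : ℕ) (x : P) : P :=
  ⟨(2⁻¹ : ℝ) ^ n • (x : E), P.smul_mem (by positivity) x.2⟩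

theorem coe_dyadicScale (n : ℕ) (x : P) : (dyadicScale n x : E) = (2⁻¹ : ℝ) ^ n • (x : E) := rfl

theorem dyadicScale_zero (x : P) : dyadicScale 0 x = x := by
  ext
  simp [coe_dyadicScale]

theorem dyadicScale_add (n : ℕ) (x y : P) :
    dyadicScale n (x + y) = dyadicScale n x + dyadicScale n y :=
  Subtype.ext (smul_add ..)

theorem dyadicScale_succ_add_self (n : ℕ) (x : P) :
    dyadicScale (n + 1) x + dyadicScale (n + 1) x = dyadicScale n x := by
  ext
  simp only [Submodule.coe_add, coe_dyadicScale, ← add_smul, pow_succ]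
  ring_nf

theorem continuous_dyadicScale (n : ℕ) : Continuous (dyadicScale n : P → P) :=
  (continuous_subtype_val.const_smul _).subtype_mk _

theorem norm_dyadicScale (n : ℕ) (x : P) :
    ‖(dyadicScale n x : E)‖ = 2⁻¹ ^ n * ‖(x : E)‖ := by
  rw [coe_dyadicScale, norm_smul, norm_pow, norm_inv, Real.norm_ofNat]

variable {F : Type*} [NormedAddCommGroup F]

/-- A function of two variables on a cone is locally dominated by `‖x‖ ‖y‖` if on each bounded set
it is at most a constant multiple of `‖x‖ ‖y‖`. In particular it vanishes to second order at the
apex, which is what makes dyadic subdivision converge. -/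
def IsLocallyNormMulBounded (c : P → P → F) : Prop :=
  ∀ R : ℝ, ∃ C : ℝ, ∀ x y : P, ‖(x : E)‖ ≤ R → ‖(y : E)‖ ≤ R →
    ‖c x y‖ ≤ C * (‖(x : E)‖ * ‖(y : E)‖)

variable [NormedSpace ℝ F]

theorem IsLocallyNormMulBounded.exists_norm_dyadicScale_le {c : P → P → F}
    (hc : IsLocallyNormMulBounded c) (R : ℝ) :
    ∃ C : ℝ, ∀ n, ∀ x y : P, ‖(x : E)‖ ≤ R → ‖(y : E)‖ ≤ R →
      ‖(2 : ℝ) ^ n • c (dyadicScale n x) (dyadicScale n y)‖ ≤ C * 2⁻¹ ^ n := by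
  obtain ⟨C, hC⟩ := hc R
  refine ⟨|C| * (R * R), fun n x y hx hy ↦ ?_⟩
  have norm_le {z : P} (hz : ‖(z : E)‖ ≤ R) : ‖(dyadicScale n z : E)‖ ≤ R :=
    (norm_dyadicScale n z).trans_le <|
      (mul_le_of_le_one_left (norm_nonneg _) (pow_le_one₀ (by norm_num) (by norm_num))).trans hz
  have hR : 0 ≤ R := (norm_nonneg _).trans hx
  calc ‖(2 : ℝ) ^ n • c (dyadicScale n x) (dyadicScale n y)‖
      = 2 ^ n * ‖c (dyadicScale n x) (dyadicScale n y)‖ := by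
        rw [norm_smul, norm_pow, Real.norm_ofNat]
    _ ≤ 2 ^ n * (C * ((2⁻¹ ^ n * ‖(x : E)‖) * (2⁻¹ ^ n * ‖(y : E)‖))) := by
        rw [← norm_dyadicScale, ← norm_dyadicScale]
        gcongr
        exact hC _ _ (norm_le hx) (norm_le hy)
    _ ≤ 2 ^ n * (|C| * ((2⁻¹ ^ n * R) * (2⁻¹ ^ n * R))) := by
        gcongr
        exact le_abs_self C
    _ = (2 * 2⁻¹) ^ n * (|C| * (R * R) * 2⁻¹ ^ n) := by
        rw [mul_pow]
        ring
    _ = |C| * (R * R) * 2⁻¹ ^ n := by norm_num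

/-- The `n`-th correction `2ⁿ c(2⁻ⁿ⁻¹ x, 2⁻ⁿ⁻¹ x)` in the dyadic subdivision of `x`. -/
noncomputable def dyadicTerm (c : P → P → F) (n : ℕ) (x : P) : F :=
  (2 : ℝ) ^ n • c (dyadicScale (n + 1) x) (dyadicScale (n + 1) x)

/-- The primitive of a symmetric cocycle obtained by repeatedly halving the argument. The equation
`c = δf` at `(x / 2, x / 2)` reads `f(x) = 2 f(x / 2) - c(x / 2, x / 2)`; iterating it
gives this series, up to a linear term. -/
noncomputable def dyadicPrimitive (c : P → P → F) (x : P) : F := -∑' n, dyadicTerm c n x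

theorem summable_mul_two_inv_pow_succ (C : ℝ) : Summable fun n : ℕ ↦ C * (2⁻¹ : ℝ) ^ (n + 1) :=
  ((summable_nat_add_iff 1).2
    (summable_geometric_of_lt_one (by norm_num) (by norm_num))).mul_left C

theorem IsLocallyNormMulBounded.exists_norm_dyadicTerm_le {c : P → P → F}
    (hc : IsLocallyNormMulBounded c) (R : ℝ) :
    ∃ C : ℝ, ∀ n, ∀ x : P, ‖(x : E)‖ ≤ R → ‖dyadicTerm c n x‖ ≤ C * 2⁻¹ ^ (n + 1) := by
  obtain ⟨C, hC⟩ := hc.exists_norm_dyadicScale_le R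
  refine ⟨C, fun n x hx ↦ (le_trans ?_ (hC (n + 1) x x hx hx))⟩
  rw [dyadicTerm, norm_smul, norm_smul, norm_pow, norm_pow]
  gcongr <;> norm_num

theorem dyadicTerm_add {c : P → P → F} (hc : IsSymmCocycle c) (n : ℕ) (x y : P) :
    dyadicTerm c n (x + y) - dyadicTerm c n x - dyadicTerm c n y =
      (2 : ℝ) ^ n • c (dyadicScale n x) (dyadicScale n y) -
        (2 : ℝ) ^ (n + 1) • c (dyadicScale (n + 1) x) (dyadicScale (n + 1) y) := by
  have h := hc.add_add_self (dyadicScale (n + 1) x) (dyadicScale (n + 1) y)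
  simp only [dyadicScale_succ_add_self] at h
  simp only [dyadicTerm, dyadicScale_add, pow_succ]
  linear_combination (norm := module) (2 : ℝ) ^ n • h

variable [CompleteSpace F]

theorem IsLocallyNormMulBounded.summable_dyadicTerm {c : P → P → F}
    (hc : IsLocallyNormMulBounded c) (x : P) : Summable fun n ↦ dyadicTerm c n x :=
  have ⟨C, hC⟩ := hc.exists_norm_dyadicTerm_le ‖(x : E)‖
  .of_norm_bounded (summable_mul_two_inv_pow_succ C) fun n ↦ hC n x le_rfl

theorem continuous_dyadicPrimitive {c : P → P → F} (hcont : Continuous fun p : P × P ↦ c p.1 p.2)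
    (hc : IsLocallyNormMulBounded c) : Continuous (dyadicPrimitive c) := by
  refine Continuous.neg (continuous_iff_continuousAt.2 fun x ↦ ?_)
  obtain ⟨C, hC⟩ := hc.exists_norm_dyadicTerm_le (‖(x : E)‖ + 1)
  have hnhds : {y : P | ‖(y : E)‖ ≤ ‖(x : E)‖ + 1} ∈ 𝓝 x :=
    (continuous_subtype_val.norm.continuousAt.eventually_lt_const
      (lt_add_one ‖(x : E)‖)).mono fun _ ↦ le_of_lt
  refine (continuousOn_tsum (fun n ↦ Continuous.continuousOn ?_) (summable_mul_two_inv_pow_succ C)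
    fun n y hy ↦ hC n y hy).continuousAt hnhds
  have hscale : Continuous (dyadicScale (n + 1) : P → P) := continuous_dyadicScale _
  exact (hcont.comp (hscale.prodMk hscale)).const_smul _

theorem addCoboundary_dyadicPrimitive {c : P → P → F} (hsymm : IsSymmCocycle c)
    (hc : IsLocallyNormMulBounded c) : addCoboundary (dyadicPrimitive c) = c := by
  ext x y
  set a : ℕ → F := fun n ↦ (2 : ℝ) ^ n • c (dyadicScale n x) (dyadicScale n y) with ha
  have ha_zero : a 0 = c x y := by simp [ha, dyadicScale_zero]
  have ha_tendsto : Tendsto a atTop (𝓝 0) := by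
    obtain ⟨C, hC⟩ := hc.exists_norm_dyadicScale_le (max ‖(x : E)‖ ‖(y : E)‖)
    refine squeeze_zero_norm (fun n ↦ hC n x y (le_max_left ..) (le_max_right ..)) ?_
    simpa using (tendsto_pow_atTop_nhds_zero_of_lt_one (r := (2⁻¹ : ℝ))
      (by norm_num) (by norm_num)).const_mul C
  have hsum := (((hc.summable_dyadicTerm (x + y)).hasSum.sub
    (hc.summable_dyadicTerm x).hasSum).sub (hc.summable_dyadicTerm y).hasSum).tendsto_sum_nat
  have htelescope (n : ℕ) : ∑ i ∈ Finset.range n,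
      (dyadicTerm c i (x + y) - dyadicTerm c i x - dyadicTerm c i y) = a 0 - a n := by
    simp only [dyadicTerm_add hsymm]
    exact Finset.sum_range_sub' a n
  simp only [htelescope] at hsum
  have hlim := tendsto_nhds_unique hsum (ha_tendsto.const_sub (a 0))
  rw [sub_zero, ha_zero] at hlim
  rw [← hlim]
  simp only [addCoboundary, dyadicPrimitive]
  abel

end Dyadic

section Averaging

variable {E : Type*} [NormedAddCommGroup E] [NormedSpace ℝ E] {P : PointedCone ℝ E}

theorem add_mem_interior {x y : E} (hx : x ∈ interior (P : Set E)) (hy : y ∈ closure (P : Set E)) :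
    x + y ∈ interior (P : Set E) := by
  have hsub : interior (P : Set E) + P ⊆ P :=
    Set.add_subset_iff.2 fun _ hu _ hv ↦ P.add_mem (interior_subset hu) hv
  have hmem : x + y ∈ interior (P : Set E) + closure (P : Set E) := Set.add_mem_add hx hy
  rw [isOpen_interior.add_closure] at hmem
  exact interior_maximal hsub isOpen_interior.add_right hmem

theorem exists_isCompact_forall_notMem_sub_notMem [ProperSpace E] {K : Set E} (hK : IsCompact K)
    (hKP : K ⊆ interior (P : Set E)) (R : ℝ) :
    ∃ C : Set E, IsCompact C ∧ C ⊆ interior (P : Set E) ∧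
      ∀ y ∈ P, ‖y‖ ≤ R → ∀ w ∉ C, w ∉ K ∧ w - y ∉ K := by
  refine ⟨K + closure (P : Set E) ∩ Metric.closedBall 0 R,
    hK.add ((isCompact_closedBall 0 R).inter_left isClosed_closure),
    Set.add_subset_iff.2 fun x hx y hy ↦ add_mem_interior (hKP hx) hy.1,
    fun y hy hyR w hw ↦ ⟨fun hwK ↦ hw ?_, fun hwK ↦ hw ?_⟩⟩
  · exact ⟨w, hwK, 0, ⟨subset_closure P.zero_mem,
      Metric.mem_closedBall_self ((norm_nonneg y).trans hyR)⟩, add_zero w⟩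
  · exact ⟨w - y, hwK, y, ⟨subset_closure hy, mem_closedBall_zero_iff.2 hyR⟩, sub_add_cancel w y⟩

variable {F : Type*} [NormedAddCommGroup F]

/-- The extension by zero of a function on a cone to the ambient space. -/
noncomputable def zeroExtend (g : P → F) : E → F := Function.extend Subtype.val g 0

theorem zeroExtend_apply_of_mem (g : P → F) {z : E} (hz : z ∈ P) : zeroExtend g z = g ⟨z, hz⟩ :=
  Subtype.val_injective.extend_apply g 0 ⟨z, hz⟩

theorem zeroExtend_add (g h : P → F) : zeroExtend (g + h) = zeroExtend g + zeroExtend h := by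
  simpa only [zeroExtend, add_zero] using Function.extend_add (Subtype.val : P → E) g h 0 0

variable [MeasurableSpace E] {μ : Measure E} [NormedSpace ℝ F]

/-- A weight for averaging functions on a cone: a Lipschitz function of integral `1`, compactly
supported in the interior of the cone. -/
structure IsAveragingWeight (μ : Measure E) (P : PointedCone ℝ E) (L : ℝ≥0) (φ : E → ℝ) :
    Prop where
  lipschitzWith : LipschitzWith L φ
  hasCompactSupport : HasCompactSupport φ
  tsupport_subset : tsupport φ ⊆ interior (P : Set E)
  integral_eq_one : ∫ z, φ z ∂μ = 1

theorem exists_isAveragingWeight [FiniteDimensional ℝ E] [BorelSpace E] [μ.IsAddHaarMeasure]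
    (hP : (interior (P : Set E)).Nonempty) : ∃ L φ, IsAveragingWeight μ P L φ := by
  obtain ⟨p, hp⟩ := hP
  obtain ⟨r, hr, hball⟩ := Metric.isOpen_iff.1 isOpen_interior p hp
  let bump : ContDiffBump p := ⟨r / 4, r / 2, by linarith, by linarith⟩
  obtain ⟨L, hL⟩ := (bump.contDiff_normed (μ := μ) (n := 1)).lipschitzWith_of_hasCompactSupport
    bump.hasCompactSupport_normed one_ne_zero
  refine ⟨L, bump.normed μ, hL, bump.hasCompactSupport_normed, ?_, bump.integral_normed⟩
  rw [bump.tsupport_normed_eq]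
  exact (Metric.closedBall_subset_ball (half_lt_self hr)).trans hball

/-- The mean `∫ φ g dμ` of a function `g` on a cone. The integral is over the whole space, with `g`
extended by zero: for a weight supported in the cone the extension is immaterial. -/
noncomputable def weightedMean (μ : Measure E) (φ : E → ℝ) (g : P → F) : F :=
  ∫ z, φ z • zeroExtend g z ∂μ

namespace IsAveragingWeight

variable {L : ℝ≥0} {φ : E → ℝ}

theorem mem_of_apply_ne_zero (hφ : IsAveragingWeight μ P L φ) {z : E} (hz : φ z ≠ 0) : z ∈ P :=
  interior_subset (hφ.tsupport_subset (subset_tsupport φ hz))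

theorem continuous_smul_zeroExtend (hφ : IsAveragingWeight μ P L φ) {X : Type*} [TopologicalSpace X]
    {c : X → P → F} (hc : Continuous fun p : X × P ↦ c p.1 p.2) :
    Continuous fun p : X × E ↦ φ p.2 • zeroExtend (c p.1) p.2 := by
  refine ContinuousOn.continuous_of_tsupport_subset (s := Set.univ ×ˢ interior (P : Set E)) ?_
    (isOpen_univ.prod isOpen_interior) ?_
  · refine (hφ.lipschitzWith.continuous.comp continuous_snd).continuousOn.smul ?_
    rw [continuousOn_iff_continuous_domRestrict]
    have hmem (p : (Set.univ : Set X) ×ˢ interior (P : Set E)) : p.1.2 ∈ P :=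
      interior_subset p.2.2
    refine Continuous.congr (f := fun p ↦ c p.1.1 ⟨p.1.2, hmem p⟩) ?_
      fun p ↦ (zeroExtend_apply_of_mem _ (hmem p)).symm
    exact hc.comp (.prodMk (by fun_prop) (.subtype_mk (by fun_prop) _))
  · calc tsupport (fun p : X × E ↦ φ p.2 • zeroExtend (c p.1) p.2)
        ⊆ tsupport (fun p : X × E ↦ φ p.2) := tsupport_smul_subset_left _ _
      _ ⊆ Prod.snd ⁻¹' tsupport φ := tsupport_comp_subset_preimage φ continuous_snd
      _ ⊆ Set.univ ×ˢ interior (P : Set E) := fun p hp ↦ ⟨trivial, hφ.tsupport_subset hp⟩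

theorem continuous_weightedMean [OpensMeasurableSpace E] [IsFiniteMeasureOnCompacts μ]
    (hφ : IsAveragingWeight μ P L φ) {X : Type*} [TopologicalSpace X] {c : X → P → F}
    (hc : Continuous fun p : X × P ↦ c p.1 p.2) :
    Continuous fun x ↦ weightedMean μ φ (c x) := by
  rw [← continuousOn_univ]
  refine continuousOn_integral_of_compact_support hφ.hasCompactSupport
    (hφ.continuous_smul_zeroExtend hc).continuousOn fun x z _ hz ↦ ?_
  rw [image_eq_zero_of_notMem_tsupport hz, zero_smul]

theorem integrable_smul_zeroExtend [OpensMeasurableSpace E] [IsFiniteMeasureOnCompacts μ]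
    (hφ : IsAveragingWeight μ P L φ) {g : P → F} (hg : Continuous g) :
    Integrable (fun z ↦ φ z • zeroExtend g z) μ :=
  ((hφ.continuous_smul_zeroExtend (X := Unit) (c := fun _ ↦ g) (by fun_prop)).comp
    (.prodMk_right ())).integrable_of_hasCompactSupport hφ.hasCompactSupport.smul_right

theorem weightedMean_const [CompleteSpace F] (hφ : IsAveragingWeight μ P L φ) (a : F) :
    weightedMean μ φ (fun _ : P ↦ a) = a := by
  have hpointwise (z : E) : φ z • zeroExtend (fun _ : P ↦ a) z = φ z • a := by
    by_cases hz : φ z = 0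
    · rw [hz, zero_smul, zero_smul]
    · rw [zeroExtend_apply_of_mem _ (hφ.mem_of_apply_ne_zero hz)]
  simp only [weightedMean, hpointwise]
  rw [integral_smul_const, hφ.integral_eq_one, one_smul]

theorem weightedMean_add [OpensMeasurableSpace E] [IsFiniteMeasureOnCompacts μ]
    (hφ : IsAveragingWeight μ P L φ) {g h : P → F} (hg : Continuous g) (hh : Continuous h) :
    weightedMean μ φ (g + h) = weightedMean μ φ g + weightedMean μ φ h := by
  simp only [weightedMean, zeroExtend_add, Pi.add_apply, smul_add]
  exact integral_add (hφ.integrable_smul_zeroExtend hg) (hφ.integrable_smul_zeroExtend hh)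

theorem smul_zeroExtend_comp_add_left (hφ : IsAveragingWeight μ P L φ) (g : P → F) (y : P) (w : E) :
    φ (w - y) • zeroExtend (fun z ↦ g (y + z)) (w - y) = φ (w - y) • zeroExtend g w := by
  by_cases hw : φ (w - y) = 0
  · rw [hw, zero_smul, zero_smul]
  · have hwy : w - y ∈ P := hφ.mem_of_apply_ne_zero hw
    have hw : w = y + (w - y) := (add_sub_cancel ..).symm
    rw [zeroExtend_apply_of_mem _ hwy, zeroExtend_apply_of_mem _ (hw ▸ P.add_mem y.2 hwy)]
    congr 2
    exact Subtype.ext hw.symm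

theorem weightedMean_comp_add_left_sub [BorelSpace E] [IsFiniteMeasureOnCompacts μ]
    [μ.IsAddRightInvariant] (hφ : IsAveragingWeight μ P L φ) {g : P → F} (hg : Continuous g)
    (y : P) :
    weightedMean μ φ (fun z ↦ g (y + z)) - weightedMean μ φ g =
      ∫ w, (φ (w - y) - φ w) • zeroExtend g w ∂μ := by
  have hint := (hφ.integrable_smul_zeroExtend (hg.comp (continuous_const_add y))).comp_sub_right
    (y : E)
  simp only [Function.comp_def, hφ.smul_zeroExtend_comp_add_left] at hint
  have hshift : weightedMean μ φ (fun z ↦ g (y + z)) = ∫ w, φ (w - y) • zeroExtend g w ∂μ := by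
    simp only [weightedMean, ← hφ.smul_zeroExtend_comp_add_left g y]
    exact (integral_sub_right_eq_self _ (y : E)).symm
  rw [hshift, weightedMean, ← integral_sub hint (hφ.integrable_smul_zeroExtend hg)]
  simp only [sub_smul]

theorem norm_weightedMean_comp_add_left_sub_le [BorelSpace E] [IsFiniteMeasureOnCompacts μ]
    [μ.IsAddRightInvariant] (hφ : IsAveragingWeight μ P L φ) {g : P → F} (hg : Continuous g)
    {y : P} {C : Set E} (hC : IsCompact C) (hCP : C ⊆ P)
    (hzero : ∀ w ∉ C, w ∉ tsupport φ ∧ w - y ∉ tsupport φ) {M : ℝ}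
    (hM : ∀ w : P, (w : E) ∈ C → ‖g w‖ ≤ M) :
    ‖weightedMean μ φ (fun z ↦ g (y + z)) - weightedMean μ φ g‖ ≤
      L * ‖(y : E)‖ * M * μ.real C := by
  rw [hφ.weightedMean_comp_add_left_sub hg, ← setIntegral_eq_integral_of_forall_compl_eq_zero
    fun w hw ↦ by
      rw [image_eq_zero_of_notMem_tsupport (hzero w hw).1,
        image_eq_zero_of_notMem_tsupport (hzero w hw).2, sub_zero, zero_smul]]
  refine norm_setIntegral_le_of_norm_le_const hC.measure_lt_top fun w hw ↦ ?_
  have hφw : ‖φ (w - y) - φ w‖ ≤ L * ‖(y : E)‖ := by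
    simpa [dist_eq_norm] using hφ.lipschitzWith.dist_le_mul (w - y) w
  rw [norm_smul, zeroExtend_apply_of_mem g (hCP hw)]
  gcongr
  exact hM _ hw

end IsAveragingWeight

/-- The modification of a cocycle `c` by the coboundary of its means `x ↦ ∫ φ(z) c(x, z) dz`. -/
noncomputable def smoothing (μ : Measure E) (φ : E → ℝ) (c : P → P → F) : P → P → F :=
  c - addCoboundary fun x ↦ weightedMean μ φ (c x)

theorem addCoboundary_weightedMean_add_smoothing (φ : E → ℝ) (c : P → P → F) :
    addCoboundary (fun x ↦ weightedMean μ φ (c x)) + smoothing μ φ c = c :=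
  add_sub_cancel _ _

variable {L : ℝ≥0} {φ : E → ℝ} {c : P → P → F}

theorem isSymmCocycle_smoothing [OpensMeasurableSpace E] [IsFiniteMeasureOnCompacts μ]
    (hφ : IsAveragingWeight μ P L φ) (hc : IsSymmCocycle c) : IsSymmCocycle (smoothing μ φ c) :=
  hc.sub (isSymmCocycle_addCoboundary (hφ.continuous_weightedMean hc.continuous))

variable [CompleteSpace F]

theorem smoothing_apply [OpensMeasurableSpace E] [IsFiniteMeasureOnCompacts μ]
    (hφ : IsAveragingWeight μ P L φ) (hc : IsCocycle c) (x y : P) :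
    smoothing μ φ c x y =
      weightedMean μ φ (fun z ↦ c x (y + z)) - weightedMean μ φ (c x) := by
  have hcont (x : P) : Continuous (c x) := hc.continuous.comp (.prodMk_right x)
  have hcont_shift : Continuous fun z ↦ c x (y + z) := (hcont x).comp (continuous_const_add y)
  have hmean : c x y + weightedMean μ φ (c (x + y)) =
      weightedMean μ φ (fun z ↦ c x (y + z)) + weightedMean μ φ (c y) := by
    have hcocycle : (fun _ ↦ c x y) + c (x + y) = (fun z ↦ c x (y + z)) + c y :=
      funext (hc.cocycle x y)
    have h := congrArg (weightedMean μ φ) hcocycle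
    rwa [hφ.weightedMean_add continuous_const (hcont _), hφ.weightedMean_const,
      hφ.weightedMean_add hcont_shift (hcont y)] at h
  simp only [smoothing, Pi.sub_apply, addCoboundary]
  linear_combination (norm := module) hmean

variable [FiniteDimensional ℝ E] [BorelSpace E] [μ.IsAddHaarMeasure]

/- The first smoothing decays in one variable; by symmetry it is then also small in the variable
over which the second smoothing averages, and the second smoothing decays in both. -/
theorem isLocallyNormMulBounded_smoothing_smoothing (hφ : IsAveragingWeight μ P L φ)
    (hc : IsSymmCocycle c) :
    IsLocallyNormMulBounded (smoothing μ φ (smoothing μ φ c)) := by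
  intro R
  obtain ⟨C, hC, hCP, hzero⟩ := exists_isCompact_forall_notMem_sub_notMem hφ.hasCompactSupport
    hφ.tsupport_subset R
  replace hCP : C ⊆ P := hCP.trans interior_subset
  have hCpre : IsCompact (((↑) : P → E) ⁻¹' C) := by
    rwa [Topology.IsInducing.subtypeVal.isCompact_preimage_iff (by simpa using hCP)]
  obtain ⟨M, hM⟩ := (hCpre.prod hCpre).exists_bound_of_continuousOn hc.continuous.continuousOn
  have smoothing_le {c : P → P → F} (hc : IsSymmCocycle c) (x : P) {y : P} (hy : ‖(y : E)‖ ≤ R)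
      {M : ℝ} (hM : ∀ w : P, (w : E) ∈ C → ‖c x w‖ ≤ M) :
      ‖smoothing μ φ c x y‖ ≤ L * ‖(y : E)‖ * M * μ.real C := by
    rw [smoothing_apply hφ hc.toIsCocycle]
    exact hφ.norm_weightedMean_comp_add_left_sub_le (hc.continuous.comp (.prodMk_right x))
      hC hCP (hzero y y.2 hy) hM
  refine ⟨L * μ.real C * (L * μ.real C) * M, fun x y hx hy ↦ ?_⟩
  have hfirst (w : P) (hw : (w : E) ∈ C) :
      ‖smoothing μ φ c x w‖ ≤ L * ‖(x : E)‖ * M * μ.real C := by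
    rw [(isSymmCocycle_smoothing hφ hc).symm]
    exact smoothing_le hc w hx fun z hz ↦ hM (w, z) ⟨hw, hz⟩
  refine (smoothing_le (isSymmCocycle_smoothing hφ hc) x hy hfirst).trans_eq ?_
  ring

end Averaging

section SymmetricCocycle

variable {E F : Type*} [NormedAddCommGroup E] [NormedSpace ℝ E] [FiniteDimensional ℝ E]
  {P : PointedCone ℝ E} [NormedAddCommGroup F] [NormedSpace ℝ F] [CompleteSpace F]

theorem IsSymmCocycle.exists_addCoboundary_eq (hP : (interior (P : Set E)).Nonempty)
    {c : P → P → F} (hc : IsSymmCocycle c) :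
    ∃ f : P → F, Continuous f ∧ addCoboundary f = c := by
  borelize E
  obtain ⟨μ, _⟩ : ∃ μ : Measure E, μ.IsAddHaarMeasure := ⟨Measure.addHaar, inferInstance⟩
  obtain ⟨L, φ, hφ⟩ := exists_isAveragingWeight (μ := μ) hP
  have hc₁ := isSymmCocycle_smoothing hφ hc
  have hc₂ := isSymmCocycle_smoothing hφ hc₁
  have hbound := isLocallyNormMulBounded_smoothing_smoothing hφ hc
  refine ⟨(fun x ↦ weightedMean μ φ (c x)) + ((fun x ↦ weightedMean μ φ (smoothing μ φ c x)) +
    dyadicPrimitive (smoothing μ φ (smoothing μ φ c))), ?_, ?_⟩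
  · exact (hφ.continuous_weightedMean hc.continuous).add
      ((hφ.continuous_weightedMean hc₁.continuous).add
        (continuous_dyadicPrimitive hc₂.continuous hbound))
  · rw [addCoboundary_add, addCoboundary_add, addCoboundary_dyadicPrimitive hc₂ hbound,
      addCoboundary_weightedMean_add_smoothing, addCoboundary_weightedMean_add_smoothing]

end SymmetricCocycle

section Extension

theorem exists_coe_sub_coe_eq {G M : Type*} [Sub G] [SetLike M G] {m : M}
    (hm : (m : Set G) - (m : Set G) = Set.univ) (x : G) : ∃ u v : m, (u : G) - v = x := by
  obtain ⟨u, hu, v, hv, huv⟩ := Set.mem_sub.1 (hm ▸ Set.mem_univ x)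
  exact ⟨⟨u, hu⟩, ⟨v, hv⟩, huv⟩

theorem exists_addMonoidHom_extension {G A : Type*} [AddCommGroup G] [AddCommGroup A]
    {M : AddSubmonoid G} (hM : (M : Set G) - (M : Set G) = Set.univ) (h : M →+ A) :
    ∃ T : G →+ A, ∀ x : M, T x = h x := by
  let f : (⊤ : AddSubmonoid M).LocalizationMap G :=
    ⟨M.subtype.toAddHom,
      { map_addUnits := fun _ ↦ AddGroup.isAddUnit _
        surj := fun x ↦ by
          obtain ⟨u, v, rfl⟩ := exists_coe_sub_coe_eq hM x
          exact ⟨(u, ⟨v, trivial⟩), sub_add_cancel (u : G) v⟩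
        exists_of_eq := fun hxy ↦ ⟨0, congrArg _ (Subtype.ext hxy)⟩ }⟩
  exact ⟨f.lift (g := h) fun _ ↦ AddGroup.isAddUnit _, f.lift_eq _⟩

theorem continuous_of_continuousAt {G A : Type*} [AddGroup G] [TopologicalSpace G]
    [IsTopologicalAddGroup G] [AddGroup A] [TopologicalSpace A] [IsTopologicalAddGroup A]
    {T : G →+ A} {p : G} (hT : ContinuousAt T p) : Continuous T := by
  refine continuous_of_continuousAt_zero T ?_
  have hshift : ContinuousAt (fun z ↦ T (z + p) - T p) 0 :=
    (ContinuousAt.comp (f := fun z ↦ z + p) (by rwa [zero_add]) (by fun_prop)).sub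
      continuousAt_const
  simpa using hshift

variable {E : Type*} [NormedAddCommGroup E] [NormedSpace ℝ E] {P : PointedCone ℝ E}

theorem interior_nonempty_of_sub_eq_univ [FiniteDimensional ℝ E]
    (hP : (P : Set E) - (P : Set E) = Set.univ) : (interior (P : Set E)).Nonempty := by
  rw [P.convex.interior_nonempty_iff_affineSpan_eq_top,
    AffineSubspace.affineSpan_eq_top_iff_vectorSpan_eq_top_of_nonempty _ _ _ ⟨0, P.zero_mem⟩,
    vectorSpan_def]
  exact (congrArg _ hP).trans Submodule.span_univ

variable {F : Type*} [NormedAddCommGroup F] [NormedSpace ℝ F]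

theorem ext_of_eqOn_cone (hP : (P : Set E) - (P : Set E) = Set.univ) {S T : E →L[ℝ] F}
    (h : Set.EqOn S T P) : S = T := by
  ext x
  obtain ⟨u, v, rfl⟩ := exists_coe_sub_coe_eq hP x
  rw [map_sub, map_sub, h u.2, h v.2]

theorem ext₂_of_eqOn_cone (hP : (P : Set E) - (P : Set E) = Set.univ) {B B' : E →L[ℝ] E →L[ℝ] F}
    (h : ∀ x y : P, B x y = B' x y) : B = B' :=
  ext_of_eqOn_cone hP fun x hx ↦ ext_of_eqOn_cone hP fun y hy ↦ h ⟨x, hx⟩ ⟨y, hy⟩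

theorem exists_continuousLinearMap_extension (hP : (P : Set E) - (P : Set E) = Set.univ)
    (hP_int : (interior (P : Set E)).Nonempty) {h : P → F} (hcont : Continuous h)
    (hadd : ∀ x y, h (x + y) = h x + h y) :
    ∃ T : E →L[ℝ] F, ∀ x : P, T x = h x := by
  obtain ⟨T, hT⟩ := exists_addMonoidHom_extension (M := P.toAddSubmonoid) hP (.mk' h hadd)
  obtain ⟨p, hp⟩ := hP_int
  have hT_on : ContinuousOn T P :=
    continuousOn_iff_continuous_domRestrict.2 (hcont.congr fun x ↦ (hT x).symm)
  have hT_at : ContinuousAt T p := hT_on.continuousAt (mem_interior_iff_mem_nhds.1 hp)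
  exact ⟨T.toRealLinearMap (continuous_of_continuousAt hT_at), hT⟩

theorem exists_bilinear_extension [FiniteDimensional ℝ E]
    (hP : (P : Set E) - (P : Set E) = Set.univ) {b : P → P → F}
    (hcont : Continuous fun p : P × P ↦ b p.1 p.2)
    (hleft : ∀ x y z, b (x + y) z = b x z + b y z)
    (hright : ∀ x y z, b x (y + z) = b x y + b x z) :
    ∃ B : E →L[ℝ] E →L[ℝ] F, ∀ x y : P, B x y = b x y := by
  have hP_int := interior_nonempty_of_sub_eq_univ hP
  choose T hT using fun x : P ↦ exists_continuousLinearMap_extension hP hP_int (h := b x)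
    (hcont.comp (.prodMk_right x)) (hright x)
  have hT_cont : Continuous T := by
    refine continuous_clm_apply.2 fun y ↦ ?_
    obtain ⟨u, v, rfl⟩ := exists_coe_sub_coe_eq hP y
    have hb_left (w : P) : Continuous fun x ↦ b x w := hcont.comp (.prodMk_left w)
    refine ((hb_left u).sub (hb_left v)).congr fun x ↦ ?_
    rw [map_sub, hT, hT, Pi.sub_apply]
  have hT_add (x y : P) : T (x + y) = T x + T y :=
    ext_of_eqOn_cone hP fun z hz ↦ by
      simpa only [← hT, add_apply] using hleft x y ⟨z, hz⟩
  obtain ⟨B, hB⟩ := exists_continuousLinearMap_extension hP hP_int hT_cont hT_add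
  exact ⟨B, fun x y ↦ by rw [hB, hT]⟩

end Extension

section Lifting

instance {E : Type*} [NormedAddCommGroup E] [NormedSpace ℝ E] (P : PointedCone ℝ E) :
    ContractibleSpace P :=
  P.convex.contractibleSpace ⟨0, P.zero_mem⟩

theorem exists_continuous_arg {X : Type*} [TopologicalSpace X] [ContractibleSpace X]
    (ω : C(X, Circle)) : ∃ θ : C(X, ℝ), ∀ x, Circle.exp (θ x) = ω x := by
  obtain ⟨y, ⟨H⟩⟩ := id_nullhomotopic X
  obtain ⟨t, ht⟩ := Circle.exp_surjective (ω y)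
  let K : C(unitInterval × X, Circle) := ω.comp H.symm.toContinuousMap
  have hK : ∀ x, K (0, x) = Circle.exp (ContinuousMap.const X t x) := fun x ↦ by simp [K, ht]
  let lift := Circle.isCoveringMap_exp.liftHomotopy K _ hK
  have hlift (x : X) : Circle.exp (lift (1, x)) = K (1, x) :=
    congrFun (Circle.isCoveringMap_exp.liftHomotopy_lifts K _ hK) (1, x)
  exact ⟨lift.comp (.prodMk (.const X 1) (.id X)), fun x ↦ (hlift x).trans (by simp [K])⟩

theorem eq_of_circleExp_eq {X : Type*} [TopologicalSpace X] [PreconnectedSpace X] {f g : X → ℝ}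
    (hf : Continuous f) (hg : Continuous g) (h : ∀ x, Circle.exp (f x) = Circle.exp (g x))
    {x₀ : X} (h₀ : f x₀ = g x₀) : f = g :=
  Circle.isCoveringMap_exp.eq_of_comp_eq hf hg (funext h) x₀ h₀

variable {S : Type*} [AddCommMonoid S] [TopologicalSpace S]

theorem exists_isCocycle_circleExp_eq [ContinuousAdd S] [ContractibleSpace S] (ω : Z2 S) :
    ∃ c : S → S → ℝ, IsCocycle c ∧
      ∀ x y, Circle.exp (c x y) = (ω : C(S × S, Circle)) (x, y) := by
  obtain ⟨c, hc⟩ := exists_continuous_arg (ω : C(S × S, Circle))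
  refine ⟨fun x y ↦ c (x, y), ⟨c.continuous, fun x y z ↦ ?_⟩, fun x y ↦ hc (x, y)⟩
  refine congrFun (eq_of_circleExp_eq
    (f := fun p : S × S × S ↦ c (p.1, p.2.1) + c (p.1 + p.2.1, p.2.2))
    (g := fun p : S × S × S ↦ c (p.1, p.2.1 + p.2.2) + c (p.2.1, p.2.2))
    (by fun_prop) (by fun_prop) (fun p ↦ ?_) (x₀ := 0) (by simp)) (x, y, z)
  simp only [Circle.exp_add, hc]
  exact ω.2 _ _ _

theorem coboundary_circleExp_apply [ContinuousAdd S] (f : C(S, ℝ)) (x y : S) :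
    (coboundary S (Circle.exp.comp f) : C(S × S, Circle)) (x, y) =
      Circle.exp (addCoboundary f x y) := by
  rw [addCoboundary, Circle.exp_sub, Circle.exp_add]
  rfl

end Lifting

section Matrices

variable {d : ℕ}

local notation "𝔼" => EuclideanSpace ℝ (Fin d)

/-- The bilinear form `⟨A x | y⟩` of a matrix `A`. -/
noncomputable def matrixForm (A : Matrix (Fin d) (Fin d) ℝ) : 𝔼 →L[ℝ] 𝔼 →L[ℝ] ℝ :=
  (innerSL ℝ : 𝔼 →L[ℝ] 𝔼 →L[ℝ] ℝ).comp (Matrix.toEuclideanLin A).toContinuousLinearMap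

/-- The skew-symmetric bilinear form `⟨A x | y⟩ - ⟨A y | x⟩` of a matrix `A`. -/
noncomputable def skewForm (A : Matrix (Fin d) (Fin d) ℝ) : 𝔼 →L[ℝ] 𝔼 →L[ℝ] ℝ :=
  matrixForm A - (matrixForm A).flip

theorem skewForm_apply (A : Matrix (Fin d) (Fin d) ℝ) (x y : 𝔼) :
    skewForm A x y = matrixForm A x y - matrixForm A y x := rfl

theorem skewForm_single (A : Matrix (Fin d) (Fin d) ℝ) (i j : Fin d) :
    skewForm A (EuclideanSpace.single i 1) (EuclideanSpace.single j 1) = A j i - A i j := by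
  simp [skewForm_apply, matrixForm, Matrix.toLpLin_apply, EuclideanSpace.inner_single_right]

theorem eq_zero_of_skewForm_eq_zero {A : Matrix (Fin d) (Fin d) ℝ} (hA : A ∈ strictUpper d)
    (h : skewForm A = 0) : A = 0 := by
  ext i j
  rcases le_or_gt j i with hji | hij
  · exact hA i j hji
  · have hji := skewForm_single A i j
    rw [h, hA j i hij.le] at hji
    simpa using hji.symm

theorem ext_single₂ {B B' : 𝔼 →L[ℝ] 𝔼 →L[ℝ] ℝ}
    (h : ∀ i j, B (EuclideanSpace.single i 1) (EuclideanSpace.single j 1) =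
      B' (EuclideanSpace.single i 1) (EuclideanSpace.single j 1)) : B = B' := by
  let basis := (EuclideanSpace.basisFun (Fin d) ℝ).toBasis
  refine ContinuousLinearMap.coe_injective (basis.ext fun i ↦ ?_)
  refine ContinuousLinearMap.coe_injective (basis.ext fun j ↦ ?_)
  simpa [basis] using h i j

theorem exists_skewForm_eq {B : 𝔼 →L[ℝ] 𝔼 →L[ℝ] ℝ} (hB : ∀ x y, B x y = -B y x) :
    ∃ A ∈ strictUpper d, skewForm A = B := by
  let e (i : Fin d) : 𝔼 := EuclideanSpace.single i 1
  refine ⟨Matrix.of fun i j ↦ if i < j then B (e j) (e i) else 0,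
    fun i j hji ↦ if_neg hji.not_gt, ext_single₂ fun i j ↦ ?_⟩
  rw [skewForm_single, Matrix.of_apply, Matrix.of_apply]
  rcases lt_trichotomy i j with hij | rfl | hji
  · rw [if_neg hij.not_gt, if_pos hij, zero_sub, ← hB]
  · rw [sub_self]
    linarith [hB (e i) (e i)]
  · rw [if_pos hji, if_neg hji.not_gt, sub_zero]

variable {P : PointedCone ℝ (EuclideanSpace ℝ (Fin d))}

theorem isCocycle_matrixForm (A : Matrix (Fin d) (Fin d) ℝ) :
    IsCocycle fun x y : P ↦ matrixForm A x y :=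
  isCocycle_of_biadditive (by fun_prop) (by simp) (by simp)

theorem exists_skewForm_eq_swap_sub (hP : (P : Set 𝔼) - (P : Set 𝔼) = Set.univ)
    {c : P → P → ℝ} (hc : IsCocycle c) :
    ∃ A ∈ strictUpper d, ∀ x y : P, skewForm A x y = c x y - c y x := by
  have hright (x y z : P) : c x (y + z) - c (y + z) x = c x y - c y x + (c x z - c z x) := by
    linarith [hc.swap_sub_add_left y z x]
  obtain ⟨B, hB⟩ := exists_bilinear_extension hP (b := fun x y ↦ c x y - c y x)
    (hc.continuous.sub (hc.continuous.comp continuous_swap)) hc.swap_sub_add_left hright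
  have hB_skew : B = -B.flip := ext₂_of_eqOn_cone hP fun x y ↦ by
    simp [hB]
  obtain ⟨A, hA, rfl⟩ := exists_skewForm_eq fun x y ↦
    DFunLike.congr_fun (DFunLike.congr_fun hB_skew x) y
  exact ⟨A, hA, hB⟩

theorem exists_matrixForm_add_addCoboundary_eq (hP : (P : Set 𝔼) - (P : Set 𝔼) = Set.univ)
    {c : P → P → ℝ} (hc : IsCocycle c) :
    ∃ A ∈ strictUpper d, ∃ f : P → ℝ, Continuous f ∧
      ∀ x y : P, c x y = matrixForm A x y + addCoboundary f x y := by
  obtain ⟨A, hA, hAc⟩ := exists_skewForm_eq_swap_sub hP hc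
  have hsymm : IsSymmCocycle (c - fun x y : P ↦ matrixForm A x y) :=
    { toIsCocycle := hc.sub (isCocycle_matrixForm A)
      symm := fun x y ↦ by
        have h := hAc x y
        rw [skewForm_apply] at h
        simp only [Pi.sub_apply]
        linarith }
  obtain ⟨f, hf, hfc⟩ := hsymm.exists_addCoboundary_eq (interior_nonempty_of_sub_eq_univ hP)
  exact ⟨A, hA, f, hf, fun x y ↦ by simp [hfc]⟩

theorem omega_apply (A : Matrix (Fin d) (Fin d) ℝ) (x y : P) :
    (omega P A : C(P × P, Circle)) (x, y) = Circle.exp (matrixForm A x y) := rfl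

variable (P) in
/-- The homomorphism `A ↦ [ω_A]` from `B₀(d)` to `H²(P, 𝕋)`. -/
noncomputable def omegaClass : Multiplicative (strictUpper d) →* H2 P where
  toFun A := QuotientGroup.mk (omega P (A.toAdd : Matrix (Fin d) (Fin d) ℝ))
  map_one' := by
    rw [← QuotientGroup.mk_one]
    congr 1
    ext p
    simp [omega]
  map_mul' A A' := by
    rw [← QuotientGroup.mk_mul]
    congr 1
    ext p
    simp [omega, inner_add_left, Circle.exp_add]

theorem circleExp_skewForm_eq_one {A : Matrix (Fin d) (Fin d) ℝ} (hA : omega P A ∈ B2 P)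
    (x y : P) : Circle.exp (skewForm A x y) = 1 := by
  obtain ⟨ψ, hψ⟩ := hA
  have hψ_apply (x y : P) : ψ x * ψ y * (ψ (x + y))⁻¹ = Circle.exp (matrixForm A x y) :=
    congrArg (fun ω : Z2 P ↦ (ω : C(P × P, Circle)) (x, y)) hψ
  rw [skewForm_apply, Circle.exp_sub, ← hψ_apply, ← hψ_apply, add_comm y x, mul_comm (ψ y),
    div_self']

theorem omegaClass_injective (hP : (P : Set 𝔼) - (P : Set 𝔼) = Set.univ) :
    Function.Injective (omegaClass P) := by
  refine (injective_iff_map_eq_one _).2 fun A hA ↦ ?_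
  have hexp := circleExp_skewForm_eq_one ((QuotientGroup.eq_one_iff _).1 hA)
  have hzero : (fun p : P × P ↦ skewForm A.toAdd.1 p.1 p.2) = fun _ ↦ 0 :=
    eq_of_circleExp_eq (by fun_prop) continuous_const
      (fun p ↦ (hexp p.1 p.2).trans Circle.exp_zero.symm) (x₀ := 0) (by simp)
  exact Subtype.ext <| eq_zero_of_skewForm_eq_zero A.toAdd.2 <|
    ext₂_of_eqOn_cone hP fun x y ↦ congrFun hzero (x, y)

theorem omegaClass_surjective (hP : (P : Set 𝔼) - (P : Set 𝔼) = Set.univ) :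
    Function.Surjective (omegaClass P) := by
  intro q
  obtain ⟨ω, rfl⟩ := QuotientGroup.mk_surjective q
  obtain ⟨c, hc, hcω⟩ := exists_isCocycle_circleExp_eq ω
  obtain ⟨A, hA, f, hf, hcf⟩ := exists_matrixForm_add_addCoboundary_eq hP hc
  have hω : omega P A * coboundary P (Circle.exp.comp ⟨f, hf⟩) = ω := by
    ext1
    ext1 ⟨x, y⟩
    rw [← hcω, hcf, Circle.exp_add, ← omega_apply]
    exact congrArg ((omega P A : C(P × P, Circle)) (x, y) * ·)
      (coboundary_circleExp_apply ⟨f, hf⟩ x y)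
  refine ⟨Multiplicative.ofAdd ⟨A, hA⟩, QuotientGroup.eq.2 ?_⟩
  exact ⟨_, eq_inv_mul_of_mul_eq hω⟩

end Matrices

theorem mainTheorem6_general (d : ℕ) (P : PointedCone ℝ (EuclideanSpace ℝ (Fin d)))
    (hspan : (P : Set (EuclideanSpace ℝ (Fin d))) - (P : Set (EuclideanSpace ℝ (Fin d)))
      = Set.univ) :
    ∃ Φ : Multiplicative (strictUpper d) ≃* H2 P, ∀ A : strictUpper d,
      Φ (Multiplicative.ofAdd A) =
        QuotientGroup.mk (omega P (A : Matrix (Fin d) (Fin d) ℝ)) :=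
  ⟨MulEquiv.ofBijective (omegaClass P) ⟨omegaClass_injective hspan, omegaClass_surjective hspan⟩,
    fun _ ↦ rfl⟩

end ConeCohomology

theorem mainTheorem6 (d : ℕ) (P : PointedCone ℝ (EuclideanSpace ℝ (Fin d)))
    (hclosed : IsClosed (P : Set (EuclideanSpace ℝ (Fin d))))
    (hspan : (P : Set (EuclideanSpace ℝ (Fin d))) - (P : Set (EuclideanSpace ℝ (Fin d)))
      = Set.univ)
    (hpointed : (P : Set (EuclideanSpace ℝ (Fin d))) ∩ -(P : Set (EuclideanSpace ℝ (Fin d)))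
      = {0}) :
    ∃ Φ : Multiplicative (ConeCohomology.strictUpper d) ≃* ConeCohomology.H2 P,
      ∀ A : ConeCohomology.strictUpper d,
        Φ (Multiplicative.ofAdd A)
          = QuotientGroup.mk (ConeCohomology.omega P (A : Matrix (Fin d) (Fin d) ℝ)) := by
  exact ConeCohomology.mainTheorem6_general d P hspan
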